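/- Let $n\ge 2$ and let $m\ge 1$ be an integer. For a bounded set $\mathscr M\subset M_n(\mathbb R)$ consider the linear switched system $$(\Sigma_{\mathscr M})\qquad \dot x(t)=A(t)x(t),\quad t\ge 0,\ x(t)\in\mathbb R^n,$$ where the switching law $A:[0,\infty)\to\mathscr M$ is an arbitrary measurable function, and let $\Phi_A(t,0)$ be its fundamental matrix, so that the trajectories for $A$ are $x(t)=\Phi_A(t,0)x(0)$. The system is called uniformly exponentially stable if there are $C,\gamma>0$ such that $\|\Phi_A(t,0)\|\le Ce^{-\gamma t}$ for every switching law $A$ and every $t\ge 0$. A continuous function $V:\mathbb R^n\to\mathbb R$ is called a common Lyapunov function for $(\Sigma_{\mathscr M})$ if $V(0)=0$, $V(x)>0$ for every $x\ne 0$, and $t\mapsto V(x(t))$ is strictly decreasing on $[0,\infty)$ along every nonzero trajectory $x$ of $(\Sigma_{\mathscr M})$. A set $\mathcal P$ of functions $\mathbb R^n\to\mathbb R$ is called a universal class of Lyapunov functions if, for every bounded set $\mathscr M\subset M_n(\mathbb R)$ such that $(\Sigma_{\mathscr M})$ is uniformly exponentially stable, there exists a common Lyapunov function for $(\Sigma_{\mathscr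 M})$ in $\mathcal P$. Then the set of all polynomial functions $\mathbb R^n\to\mathbb R$ of degree at most $m$ is not a universal class of Lyapunov functions. -/

import Mathlib

open scoped Matrix

namespace SwitchedSystem

noncomputable section

-- Matrices carry the operator norm induced by the Euclidean norm.
open scoped Matrix.Norms.L2Operator

variable {n : ℕ}

/-- Switching laws on `[0, ∞)`: Lebesgue measurable functions with values in `M`. Only the values at
nonnegative times matter. (For the finite-dimensional target, being a.e. strongly measurable with
respect to Lebesgue measure is the same as being Lebesgue measurable.) -/
def switchingLaws (M : Set (Matrix (Fin n) (Fin n) ℝ)) : Set (ℝ → Matrix (Fin n) (Fin n) ℝ) :=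
  {A | MeasureTheory.AEStronglyMeasurable A (MeasureTheory.volume.restrict (Set.Ici 0)) ∧
    ∀ t, 0 ≤ t → A t ∈ M}

/-- `x` is a (Carathéodory) solution on `[0, ∞)` of `x'(t) = A(t) x(t)`, in integral form. -/
def IsTrajectory (A : ℝ → Matrix (Fin n) (Fin n) ℝ) (x : ℝ → Fin n → ℝ) : Prop :=
  ContinuousOn x (Set.Ici 0) ∧ ∀ t, 0 ≤ t → x t = x 0 + ∫ s in (0 : ℝ)..t, A s *ᵥ x s

/-- `Φ` is the fundamental matrix `t ↦ Φ_A(t, 0)` of `x'(t) = A(t) x(t)`, i.e. the (unique)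
Carathéodory solution on `[0, ∞)` of `Φ'(t) = A(t) Φ(t)`, `Φ(0) = 1`, in integral form. -/
def IsFundamentalMatrix (A Φ : ℝ → Matrix (Fin n) (Fin n) ℝ) : Prop :=
  ContinuousOn Φ (Set.Ici 0) ∧ ∀ t, 0 ≤ t → Φ t = 1 + ∫ s in (0 : ℝ)..t, A s * Φ s

/-- Uniform exponential stability of the switched system with set of modes `M`. -/
def UniformlyExponentiallyStable (M : Set (Matrix (Fin n) (Fin n) ℝ)) : Prop :=
  ∃ C > 0, ∃ γ > 0, ∀ A ∈ switchingLaws M, ∀ Φ, IsFundamentalMatrix A Φ →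
    ∀ t, 0 ≤ t → ‖Φ t‖ ≤ C * Real.exp (-γ * t)

/-- `V` is a (strict) common Lyapunov function for the switched system with set of modes `M`. -/
structure IsCommonLyapunov (M : Set (Matrix (Fin n) (Fin n) ℝ)) (V : (Fin n → ℝ) → ℝ) : Prop where
  continuous : Continuous V
  map_zero : V 0 = 0
  pos : ∀ x, x ≠ 0 → 0 < V x
  strictAnti : ∀ A ∈ switchingLaws M, ∀ x, IsTrajectory A x → x 0 ≠ 0 →
    StrictAntiOn (fun t => V (x t)) (Set.Ici 0)

/-- The class `P` contains a common Lyapunov function for every uniformly exponentially stable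
switched system with a bounded set of modes. -/
def IsUniversalClass (P : Set ((Fin n → ℝ) → ℝ)) : Prop :=
  ∀ M : Set (Matrix (Fin n) (Fin n) ℝ), Bornology.IsBounded M → UniformlyExponentiallyStable M →
    ∃ V ∈ P, IsCommonLyapunov M V

/-- Polynomial functions on `ℝⁿ` of degree at most `m`. -/
def polynomialsOfDegreeLE (n m : ℕ) : Set ((Fin n → ℝ) → ℝ) :=
  {V | ∃ p : MvPolynomial (Fin n) ℝ, p.totalDegree ≤ m ∧ ∀ x, V x = MvPolynomial.eval x p}

end

end SwitchedSystem

/-! The modes relax `x i` towards `σ * x j`, `|σ| ≤ 1`, with an extra decay at rate `ε`. Each mode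
is `-(1 + ε)` plus a sup-norm contraction, so the family is uniformly exponentially stable for every
`ε > 0` (`IsTrajectory.norm_le`). If degree `≤ m` sufficed for all `ε`, Lyapunov polynomials for `ε
→ 0` could be rescaled to converge to some `q ≠ 0` with `q 0 = 0` (`exists_subseq_tendsto_eval`),
the space being finite-dimensional. In the limit, `q` does not increase when `x i` is replaced by `σ
* x j`. Hence all points of an interval minimise the one-variable polynomial `x i ↦ q x`, which is
therefore constant (`eval_update_eq`). So `q` is constant, hence zero: a contradiction. -/

namespace SwitchedSystem
open Filter Topology Set MeasureTheory
open scoped Matrix.Norms.L2Operator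

/-! ### Exponential decay from sup-norm contraction -/

section Stability

variable {n : ℕ}

/-- Integrability on bounded intervals of the right-hand side along a continuous curve. -/
lemma intervalIntegrable_mulVec {A : ℝ → Matrix (Fin n) (Fin n) ℝ} {x : ℝ → Fin n → ℝ} {K : ℝ}
    (hA : AEStronglyMeasurable A (volume.restrict (Ici 0)))
    (hK : ∀ t, 0 ≤ t → ∀ v, ‖A t *ᵥ v‖ ≤ K * ‖v‖) (hx : ContinuousOn x (Ici 0))
    {a b : ℝ} (ha : 0 ≤ a) (hab : a ≤ b) :
    IntervalIntegrable (fun s => A s *ᵥ x s) volume a b := by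
  have hsub : Icc a b ⊆ Ici 0 := fun s hs => ha.trans hs.1
  rw [intervalIntegrable_iff_integrableOn_Icc_of_le hab]
  have hxI := hx.mono hsub
  refine Integrable.mono' (g := fun s => K * ‖x s‖)
    (ContinuousOn.integrableOn_Icc (continuousOn_const.mul hxI.norm)) ?_ ?_
  · have hc : Continuous fun p : Matrix (Fin n) (Fin n) ℝ × (Fin n → ℝ) => p.1 *ᵥ p.2 := by
      fun_prop
    exact hc.comp_aestronglyMeasurable ((hA.mono_measure (Measure.restrict_mono hsub le_rfl)).prodMk
      (hxI.aestronglyMeasurable measurableSet_Icc))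
  · exact (ae_restrict_iff' measurableSet_Icc).2 (Eventually.of_forall fun s hs => hK s (hsub hs) _)

/-- If `v + (A t + ε) v` contracts the sup norm, trajectories decay exponentially at rate `ε`. -/
lemma IsTrajectory.norm_le {A : ℝ → Matrix (Fin n) (Fin n) ℝ} {x : ℝ → Fin n → ℝ} {ε : ℝ}
    (hε : 0 < ε) (hA : AEStronglyMeasurable A (volume.restrict (Ici 0)))
    (hc : ∀ t, 0 ≤ t → ∀ v, ‖A t *ᵥ v + (1 + ε) • v‖ ≤ ‖v‖) (hx : IsTrajectory A x)
    {t : ℝ} (ht : 0 ≤ t) : ‖x t‖ ≤ ‖x 0‖ * Real.exp (-ε * t) := by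
  have hK : ∀ t, 0 ≤ t → ∀ v, ‖A t *ᵥ v‖ ≤ (2 + ε) * ‖v‖ := fun t ht v => by
    calc ‖A t *ᵥ v‖ = ‖(A t *ᵥ v + (1 + ε) • v) - (1 + ε) • v‖ := by rw [add_sub_cancel_right]
      _ ≤ ‖v‖ + (1 + ε) * ‖v‖ := by
        refine (norm_sub_le _ _).trans (add_le_add (hc t ht v) ?_)
        rw [norm_smul, Real.norm_of_nonneg (by linarith)]
      _ = _ := by ring
  have hint := fun a b (ha : (0 : ℝ) ≤ a) (hab : a ≤ b) => intervalIntegrable_mulVec hA hK hx.1 ha hab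
  have key := le_gronwallBound_of_liminf_deriv_right_le (f := fun s => ‖x s‖)
    (f' := fun s => -ε * ‖x s‖) (δ := ‖x 0‖) (K := -ε) (ε := 0) (a := 0) (b := t)
    (hx.1.norm.mono fun s hs => hs.1) ?_ le_rfl (fun s _ => by simp) t ⟨ht, le_rfl⟩
  · simpa [gronwallBound_ε0] using key
  intro s hs r hr
  refine Eventually.frequently ?_
  -- Replacing `x u` by `x s` costs `δ` in `‖x u‖` and `(1 + ε) * δ` in the shift, hence `2 + ε`.
  obtain ⟨δ, hδ, hδr⟩ : ∃ δ > 0, -ε * ‖x s‖ + (2 + ε) * δ < r := by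
    refine ⟨(r + ε * ‖x s‖) / (2 * (2 + ε)), div_pos (by linarith) (by linarith), ?_⟩
    have : (2 + ε) * ((r + ε * ‖x s‖) / (2 * (2 + ε))) = (r + ε * ‖x s‖) / 2 := by
      field_simp
    rw [this]; linarith
  have hcont : ContinuousWithinAt x (Ici s) s :=
    (hx.1 s hs.1).mono (Ici_subset_Ici.2 hs.1)
  obtain ⟨η, hη, hball⟩ := Metric.continuousWithinAt_iff.1 hcont δ hδ
  -- The bound `1 / (1 + ε)` keeps the coefficient of `x s` in `heq` nonnegative.
  have hnear : ∀ᶠ z in 𝓝[>] s, z < s + min η (1 / (1 + ε)) :=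
    nhdsWithin_le_nhds (Iio_mem_nhds (by
      have : 0 < min η (1 / (1 + ε)) := lt_min hη (by positivity)
      linarith))
  filter_upwards [hnear, self_mem_nhdsWithin] with z hz hsz
  rw [mem_Ioi] at hsz
  have hz1 : z - s < η := by linarith [min_le_left η (1 / (1 + ε))]
  have hz2 : (1 + ε) * (z - s) ≤ 1 := by
    have : z - s ≤ 1 / (1 + ε) := by linarith [min_le_right η (1 / (1 + ε))]
    rwa [le_div_iff₀' (by linarith)] at this
  -- Since `A` is only measurable, the Dini derivative of the norm is bounded through the integral
  -- form.
  have heq : x z = (1 - (1 + ε) * (z - s)) • x s + ∫ u in s..z, (A u *ᵥ x u + (1 + ε) • x s) := by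
    rw [intervalIntegral.integral_add (hint s z hs.1 hsz.le) intervalIntegrable_const,
      intervalIntegral.integral_const, hx.2 z (hs.1.trans hsz.le),
      ← intervalIntegral.integral_add_adjacent_intervals (hint 0 s le_rfl hs.1)
        (hint s z hs.1 hsz.le), ← add_assoc, ← hx.2 s hs.1]
    module
  have hI : ‖∫ u in s..z, (A u *ᵥ x u + (1 + ε) • x s)‖ ≤
      (‖x s‖ + (2 + ε) * δ) * |z - s| := by
    refine intervalIntegral.norm_integral_le_of_norm_le_const fun u hu => ?_
    rw [uIoc_of_le hsz.le] at hu
    have hd : ‖x u - x s‖ < δ := by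
      rw [← dist_eq_norm]
      refine hball hu.1.le ?_
      rw [Real.dist_eq, abs_of_pos (by linarith [hu.1])]
      linarith [hu.2]
    have h1 := hc u (hs.1.trans hu.1.le) (x u)
    have h2 : ‖x u‖ ≤ ‖x s‖ + δ := by
      have := norm_add_le (x s) (x u - x s)
      rw [add_sub_cancel] at this
      linarith
    calc ‖A u *ᵥ x u + (1 + ε) • x s‖
        = ‖(A u *ᵥ x u + (1 + ε) • x u) - (1 + ε) • (x u - x s)‖ := by congr 1; module
      _ ≤ ‖x u‖ + (1 + ε) * ‖x u - x s‖ := by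
        refine (norm_sub_le _ _).trans (add_le_add h1 ?_)
        rw [norm_smul, Real.norm_of_nonneg (by linarith)]
      _ ≤ _ := by nlinarith
  rw [abs_of_pos (by linarith)] at hI
  have hn : ‖x z‖ ≤ (1 - (1 + ε) * (z - s)) * ‖x s‖ + (‖x s‖ + (2 + ε) * δ) * (z - s) := by
    rw [heq]
    refine (norm_add_le _ _).trans (add_le_add ?_ hI)
    rw [norm_smul, Real.norm_of_nonneg (by linarith)]
  rw [inv_mul_lt_iff₀ (by linarith)]
  have := mul_lt_mul_of_pos_left hδr (sub_pos.2 hsz)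
  nlinarith

/-- Applying a fundamental matrix to a vector gives a trajectory. -/
lemma IsFundamentalMatrix.isTrajectory {A Φ : ℝ → Matrix (Fin n) (Fin n) ℝ} {R : ℝ}
    (hA : AEStronglyMeasurable A (volume.restrict (Ici 0))) (hR : ∀ t, 0 ≤ t → ‖A t‖ ≤ R)
    (hΦ : IsFundamentalMatrix A Φ) (v : Fin n → ℝ) : IsTrajectory A fun t => Φ t *ᵥ v := by
  let L : Matrix (Fin n) (Fin n) ℝ →L[ℝ] (Fin n → ℝ) :=
    LinearMap.toContinuousLinearMap ((Matrix.mulVecBilin ℝ ℝ).flip v)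
  have hL : ∀ B, L B = B *ᵥ v := fun B => rfl
  refine ⟨L.continuous.comp_continuousOn hΦ.1, fun t ht => ?_⟩
  have h0 : Φ 0 = 1 := by simpa using hΦ.2 0 le_rfl
  have hsub : Icc 0 t ⊆ Ici (0 : ℝ) := fun s hs => hs.1
  have hΦI := hΦ.1.mono hsub
  have hint : IntervalIntegrable (fun s => A s * Φ s) volume 0 t := by
    rw [intervalIntegrable_iff_integrableOn_Icc_of_le ht]
    refine Integrable.mono' (g := fun s => R * ‖Φ s‖)
      (ContinuousOn.integrableOn_Icc (continuousOn_const.mul hΦI.norm)) ?_ ?_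
    · exact (hA.mono_measure (Measure.restrict_mono hsub le_rfl)).mul
        (hΦI.aestronglyMeasurable measurableSet_Icc)
    · exact (ae_restrict_iff' measurableSet_Icc).2 (Eventually.of_forall fun s hs =>
        (norm_mul_le _ _).trans (mul_le_mul_of_nonneg_right (hR s hs.1) (norm_nonneg _)))
  simp only [← hL]
  rw [h0, hΦ.2 t ht, map_add, ← L.intervalIntegral_comp_comm hint]
  simp only [hL, Matrix.mulVec_mulVec]

/-- A bounded set of modes contracting the sup norm at rate `ε` is uniformly exponentially
stable. -/
lemma uniformlyExponentiallyStable_of_contracting {M : Set (Matrix (Fin n) (Fin n) ℝ)} {ε : ℝ}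
    (hε : 0 < ε) (hM : Bornology.IsBounded M)
    (hc : ∀ B ∈ M, ∀ v, ‖B *ᵥ v + (1 + ε) • v‖ ≤ ‖v‖) : UniformlyExponentiallyStable M := by
  obtain ⟨R, hR⟩ := hM.exists_norm_le
  -- The sum turns entrywise bounds into an operator norm bound; `+ 1` keeps `C` positive when `n =
  -- 0`.
  refine ⟨(∑ i : Fin n, ∑ j : Fin n, ‖(Matrix.single i j 1 : Matrix (Fin n) (Fin n) ℝ)‖) + 1,
    by positivity, ε, hε, fun A hA Φ hΦ t ht => ?_⟩
  have h0 : Φ 0 = 1 := by simpa using hΦ.2 0 le_rfl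
  have hentry : ∀ i j, |Φ t i j| ≤ Real.exp (-ε * t) := fun i j => by
    have h := (hΦ.isTrajectory hA.1 (fun s hs => hR _ (hA.2 s hs)) (Pi.single j 1)).norm_le hε hA.1
      (fun s hs => hc _ (hA.2 s hs)) ht
    have h2 := norm_le_pi_norm (Φ t *ᵥ Pi.single j 1) i
    simp only [h0, Matrix.one_mulVec, Pi.norm_single, norm_one, one_mul] at h
    rw [Matrix.mulVec_single_one] at h h2
    exact h2.trans h
  calc ‖Φ t‖ = ‖∑ i, ∑ j, Φ t i j • (Matrix.single i j 1 : Matrix (Fin n) (Fin n) ℝ)‖ := by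
        congr 1
        simpa using Matrix.matrix_eq_sum_single (Φ t)
    _ ≤ ∑ i, ∑ j, ‖(Matrix.single i j 1 : Matrix (Fin n) (Fin n) ℝ)‖ * Real.exp (-ε * t) := by
        refine norm_sum_le_of_le _ fun i _ => norm_sum_le_of_le _ fun j _ => ?_
        rw [norm_smul, mul_comm]
        exact mul_le_mul_of_nonneg_left (hentry i j) (norm_nonneg _)
    _ = (∑ i : Fin n, ∑ j : Fin n, ‖(Matrix.single i j 1 : Matrix (Fin n) (Fin n) ℝ)‖) *
          Real.exp (-ε * t) := by simp only [Finset.sum_mul]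
    _ ≤ _ := by gcongr; linarith

end Stability

/-! ### The relaxation modes and their flows -/

section Modes

variable {n : ℕ}

/-- The matrix of the linear system relaxing `x i` towards `σ * x j` at unit rate, together with an
overall decay at rate `ε`. -/
noncomputable def relaxation (ε : ℝ) (i j : Fin n) (σ : ℝ) : Matrix (Fin n) (Fin n) ℝ :=
  Matrix.updateRow 1 i (σ • Pi.single j 1) - (1 + ε) • (1 : Matrix (Fin n) (Fin n) ℝ)

/-- All relaxation matrices with decay rate `ε` that do not increase the sup norm when `ε = 0`. -/
def relaxations (n : ℕ) (ε : ℝ) : Set (Matrix (Fin n) (Fin n) ℝ) :=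
  ⋃ (i : Fin n) (j : Fin n), relaxation ε i j '' Icc (-1) 1

lemma relaxation_mulVec (ε : ℝ) (i j : Fin n) (σ : ℝ) (v : Fin n → ℝ) :
    relaxation ε i j σ *ᵥ v = Function.update v i (σ * v j) - (1 + ε) • v := by
  simp [relaxation, Matrix.sub_mulVec, Matrix.updateRow_mulVec, Matrix.smul_mulVec]

lemma isBounded_relaxations (ε : ℝ) : Bornology.IsBounded (relaxations n ε) := by
  refine (isCompact_iUnion fun i => isCompact_iUnion fun j => isCompact_Icc.image ?_).isBounded
  have : Continuous fun σ : ℝ => (1 : Matrix (Fin n) (Fin n) ℝ).updateRow i (σ • Pi.single j 1) := by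
    fun_prop
  exact this.sub continuous_const

lemma norm_update_le (i j : Fin n) {σ : ℝ} (hσ : σ ∈ Icc (-1 : ℝ) 1) (v : Fin n → ℝ) :
    ‖Function.update v i (σ * v j)‖ ≤ ‖v‖ := by
  refine (pi_norm_le_iff_of_nonneg (norm_nonneg _)).2 fun k => ?_
  rcases eq_or_ne k i with rfl | hk
  · rw [Function.update_self, norm_mul]
    exact (mul_le_of_le_one_left (norm_nonneg _) (abs_le.2 hσ)).trans (norm_le_pi_norm v j)
  · rw [Function.update_of_ne hk]
    exact norm_le_pi_norm v k

lemma uniformlyExponentiallyStable_relaxations {ε : ℝ} (hε : 0 < ε) :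
    UniformlyExponentiallyStable (relaxations n ε) := by
  refine uniformlyExponentiallyStable_of_contracting hε (isBounded_relaxations ε) fun B hB v => ?_
  simp only [relaxations, mem_iUnion, mem_image] at hB
  obtain ⟨i, j, σ, hσ, rfl⟩ := hB
  rw [relaxation_mulVec, sub_add_cancel]
  exact norm_update_le i j hσ v

/-- The explicit trajectory of a relaxation system. -/
noncomputable def relaxationFlow (ε : ℝ) (i j : Fin n) (σ : ℝ) (x : Fin n → ℝ) (t : ℝ) :
    Fin n → ℝ :=
  Real.exp (-(ε * t)) • Function.update x i (σ * x j + Real.exp (-t) * (x i - σ * x j))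

lemma relaxationFlow_zero (ε : ℝ) (i j : Fin n) (σ : ℝ) (x : Fin n → ℝ) :
    relaxationFlow ε i j σ x 0 = x := by
  simp [relaxationFlow]

/-- Up to the factor `exp (-(ε * t))`, coordinate `j ≠ i` is frozen and coordinate `i` solves `y' =
σ * x j - y`. -/
lemma hasDerivAt_relaxationFlow (ε : ℝ) {i j : Fin n} (hij : i ≠ j) (σ : ℝ) (x : Fin n → ℝ)
    (t : ℝ) : HasDerivAt (relaxationFlow ε i j σ x)
      (relaxation ε i j σ *ᵥ relaxationFlow ε i j σ x t) t := by
  rw [hasDerivAt_pi]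
  intro k
  have h1 : HasDerivAt (fun t : ℝ => Real.exp (-(ε * t))) (Real.exp (-(ε * t)) * -ε) t := by
    simpa using ((hasDerivAt_id t).const_mul ε).neg.exp
  have h2 : HasDerivAt (fun t : ℝ => Real.exp (-t)) (-Real.exp (-t)) t := by
    simpa using (hasDerivAt_id t).neg.exp
  rw [relaxation_mulVec]
  rcases eq_or_ne k i with rfl | hk
  · simp only [relaxationFlow, Pi.smul_apply, Pi.sub_apply, Function.update_self, smul_eq_mul,
      Function.update_of_ne hij.symm]
    refine (h1.mul ((h2.mul_const (x k - σ * x j)).const_add (σ * x j))).congr_deriv ?_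
    ring
  · simp only [relaxationFlow, Pi.smul_apply, Pi.sub_apply, Function.update_of_ne hk, smul_eq_mul]
    refine (h1.mul_const (x k)).congr_deriv ?_
    ring

lemma isTrajectory_relaxationFlow (ε : ℝ) {i j : Fin n} (hij : i ≠ j) (σ : ℝ) (x : Fin n → ℝ) :
    IsTrajectory (fun _ => relaxation ε i j σ) (relaxationFlow ε i j σ x) := by
  have hd := hasDerivAt_relaxationFlow ε hij σ x
  have hc : Continuous (relaxationFlow ε i j σ x) :=
    continuous_iff_continuousAt.2 fun t => (hd t).continuousAt
  refine ⟨hc.continuousOn, fun t _ => ?_⟩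
  rw [intervalIntegral.integral_eq_sub_of_hasDerivAt (fun s _ => hd s)
    (Continuous.intervalIntegrable (by fun_prop) _ _), add_sub_cancel]

/-- Constant switching laws suffice, and the weak inequality is what survives the limit `ε → 0`. -/
lemma IsCommonLyapunov.relaxationFlow_le {ε : ℝ} {V : (Fin n → ℝ) → ℝ}
    (hV : IsCommonLyapunov (relaxations n ε) V) {i j : Fin n} (hij : i ≠ j) {σ : ℝ}
    (hσ : σ ∈ Icc (-1 : ℝ) 1) (x : Fin n → ℝ) {t : ℝ} (ht : 0 ≤ t) :
    V (relaxationFlow ε i j σ x t) ≤ V x := by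
  rcases eq_or_ne x 0 with rfl | hx
  · simp [relaxationFlow]
  have hA : (fun _ : ℝ => relaxation ε i j σ) ∈ switchingLaws (relaxations n ε) :=
    ⟨aestronglyMeasurable_const, fun _ _ => mem_iUnion₂.2 ⟨i, j, mem_image_of_mem _ hσ⟩⟩
  have h := (hV.strictAnti _ hA _ (isTrajectory_relaxationFlow ε hij σ x)
    (by rwa [relaxationFlow_zero])).antitoneOn self_mem_Ici ht ht
  simpa only [relaxationFlow_zero] using h

/-- As the decay rate vanishes, relaxation reaches its target. -/
lemma tendsto_relaxationFlow (i j : Fin n) (σ : ℝ) (x : Fin n → ℝ) :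
    Tendsto (fun k : ℕ => relaxationFlow (1 / ((k : ℝ) + 1) ^ 2) i j σ x ((k : ℝ) + 1)) atTop
      (𝓝 (Function.update x i (σ * x j))) := by
  have ht : Tendsto (fun k : ℕ => (k : ℝ) + 1) atTop atTop :=
    tendsto_atTop_add_const_right _ _ tendsto_natCast_atTop_atTop
  -- Decay at rate `1 / t ^ 2` over time `t` has total exponent `1 / t → 0`, while `exp (-t) → 0`
  -- completes the relaxation.
  have h1 : Tendsto (fun k : ℕ => Real.exp (-(1 / ((k : ℝ) + 1) ^ 2 * ((k : ℝ) + 1)))) atTop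
      (𝓝 1) := by
    have : Tendsto (fun k : ℕ => -(1 / ((k : ℝ) + 1) ^ 2 * ((k : ℝ) + 1))) atTop (𝓝 0) := by
      have := (tendsto_inv_atTop_zero.comp ht).neg
      rw [neg_zero] at this
      refine this.congr fun k => ?_
      have : (k : ℝ) + 1 ≠ 0 := by positivity
      simp only [Function.comp]
      field_simp
    simpa [Function.comp_def] using (Real.continuous_exp.tendsto 0).comp this
  have h2 : Tendsto (fun k : ℕ => Real.exp (-((k : ℝ) + 1))) atTop (𝓝 0) :=
    Real.tendsto_exp_neg_atTop_nhds_zero.comp ht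
  have h3 : Tendsto (fun k : ℕ => Function.update x i
      (σ * x j + Real.exp (-((k : ℝ) + 1)) * (x i - σ * x j))) atTop
      (𝓝 (Function.update x i (σ * x j))) := by
    refine tendsto_const_nhds.update i ?_
    simpa using (h2.mul_const (x i - σ * x j)).const_add (σ * x j)
  simpa [relaxationFlow] using h1.smul h3

end Modes

/-! ### Rigidity and compactness of polynomials -/

section Polynomials

variable {n : ℕ}

/-- A polynomial that does not increase when `x i` is replaced by `σ * x j` with `|σ| ≤ 1` does not
depend on `x i`. -/
lemma eval_update_eq {p : MvPolynomial (Fin n) ℝ} {i j : Fin n} (hij : i ≠ j)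
    (hp : ∀ σ ∈ Icc (-1 : ℝ) 1, ∀ x : Fin n → ℝ,
      p.eval (Function.update x i (σ * x j)) ≤ p.eval x) (x : Fin n → ℝ) (s : ℝ) :
    p.eval (Function.update x i s) = p.eval x := by
  have hne : ∀ x : Fin n → ℝ, x j ≠ 0 → ∀ s,
      p.eval (Function.update x i s) = p.eval (Function.update x i 0) := by
    intro x hxj s
    let q : Polynomial ℝ := MvPolynomial.aeval
      (Function.update (fun k => Polynomial.C (x k)) i Polynomial.X) p
    have hq : ∀ s, q.eval s = p.eval (Function.update x i s) := fun s => by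
      simp only [q, ← Polynomial.coe_evalRingHom, MvPolynomial.aeval_def, MvPolynomial.eval,
        MvPolynomial.hom_eval₂]
      congr 1
      · ext; simp
      · funext k
        rcases eq_or_ne k i with rfl | hk <;> simp [*]
    -- As `x j ≠ 0`, `σ * x j` sweeps `[-|x j|, |x j|]`; each such `b` is a global minimiser of `q`.
    have hle : ∀ a b, |b| ≤ |x j| → q.eval b ≤ q.eval a := fun a b hb => by
      have hσ : b / x j ∈ Icc (-1 : ℝ) 1 := by
        rw [mem_Icc, ← abs_le, abs_div]
        exact div_le_one_of_le₀ hb (abs_nonneg _)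
      have h := hp _ hσ (Function.update x i a)
      rwa [Function.update_of_ne hij.symm, div_mul_cancel₀ _ hxj, Function.update_idem,
        ← hq, ← hq] at h
    have hconst : q = Polynomial.C (q.eval 0) := by
      refine Polynomial.eq_of_infinite_eval_eq _ _
        ((Icc_infinite (abs_pos.2 hxj)).mono fun b hb => ?_)
      rw [mem_ofPred_eq, Polynomial.eval_C]
      exact le_antisymm (hle 0 b (by rw [abs_of_nonneg hb.1]; exact hb.2))
        (hle b 0 (by simp))
    rw [← hq, ← hq, hconst, Polynomial.eval_C, Polynomial.eval_C]
  have hall : ∀ s, p.eval (Function.update x i s) = p.eval (Function.update x i 0) := fun s => by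
    -- The case `x j = 0` follows by continuity and density.
    have hcont : ∀ s : ℝ, Continuous fun t =>
        p.eval (Function.update (Function.update x j t) i s) := fun s => by
      have hu : Continuous fun t : ℝ => Function.update (Function.update x j t) i s :=
        Continuous.update (Continuous.update (continuous_const (y := x)) j continuous_id) i
          continuous_const
      exact (MvPolynomial.continuous_eval p).comp hu
    have := Continuous.ext_on (dense_compl_singleton (0 : ℝ)) (hcont s) (hcont 0) fun t ht =>
      hne (Function.update x j t) (by simpa using ht) s
    simpa using congrFun this (x j)
  rw [hall, ← hall (x i), Function.update_eq_self]

/-- The coordinates can be set to zero one at a time. -/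
lemma eval_eq_eval_zero {p : MvPolynomial (Fin n) ℝ}
    (hp : ∀ (i : Fin n) (x : Fin n → ℝ), p.eval (Function.update x i 0) = p.eval x)
    (x : Fin n → ℝ) : p.eval x = p.eval 0 := by
  have h : ∀ S : Finset (Fin n), p.eval (fun k => if k ∈ S then 0 else x k) = p.eval x := by
    intro S
    induction S using Finset.induction_on with
    | empty => simp
    | insert a S ha ih =>
      rw [← ih, ← hp a (fun k => if k ∈ S then 0 else x k)]
      congr 2
      funext k
      by_cases hk : k = a <;> simp [hk]
  rw [← h Finset.univ]
  simp only [Finset.mem_univ, if_true]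
  rfl

/-- Compactness of the space of polynomials of bounded degree: nonzero polynomials can be rescaled
by positive factors so that a subsequence converges, locally uniformly, to a nonzero polynomial. -/
lemma exists_subseq_tendsto_eval {m : ℕ} {p : ℕ → MvPolynomial (Fin n) ℝ}
    (hdeg : ∀ k, (p k).totalDegree ≤ m) (hp : ∀ k, p k ≠ 0) :
    ∃ (q : MvPolynomial (Fin n) ℝ) (r : ℕ → ℝ) (φ : ℕ → ℕ), q ≠ 0 ∧ (∀ k, 0 < r k) ∧ StrictMono φ ∧
      ∀ (y : ℕ → Fin n → ℝ) (x : Fin n → ℝ), Tendsto y atTop (𝓝 x) →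
        Tendsto (fun k => r (φ k) * (p (φ k)).eval (y (φ k))) atTop (𝓝 (q.eval x)) := by
  let W := MvPolynomial.restrictTotalDegree (Fin n) ℝ m
  let b := Module.finBasis ℝ W
  let w : ℕ → W := fun k => ⟨p k, (MvPolynomial.mem_restrictTotalDegree _ _ _).2 (hdeg k)⟩
  let c : ℕ → Fin (Module.finrank ℝ W) → ℝ := fun k => b.equivFun (w k)
  have hc : ∀ k, c k ≠ 0 := fun k h => hp k <| by
    have : w k = 0 := b.equivFun.map_eq_zero_iff.1 h
    simpa [w] using congrArg Subtype.val this
  -- Limits of unit coordinate vectors stay on the sphere, which makes `q` nonzero.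
  obtain ⟨d, hd, φ, hφ, hlim⟩ := (isCompact_sphere (0 : Fin (Module.finrank ℝ W) → ℝ) 1).tendsto_subseq
    (x := fun k => ‖c k‖⁻¹ • c k) fun k => by
      simp [norm_smul, inv_mul_cancel₀ (norm_ne_zero_iff.2 (hc k))]
  have heval : ∀ (a : Fin (Module.finrank ℝ W) → ℝ) (x : Fin n → ℝ),
      (b.equivFun.symm a : MvPolynomial (Fin n) ℝ).eval x =
        ∑ l, a l * (b l : MvPolynomial (Fin n) ℝ).eval x := fun a x => by
    simp [Module.Basis.equivFun_symm_apply, MvPolynomial.smul_eval]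
  refine ⟨(b.equivFun.symm d : W), fun k => ‖c k‖⁻¹, φ, ?_,
    fun k => inv_pos.2 (norm_pos_iff.2 (hc k)), hφ, fun y x hy => ?_⟩
  · intro h
    have : d = 0 := b.equivFun.symm.map_eq_zero_iff.1 (Subtype.ext h)
    simp [this] at hd
  · rw [heval]
    have h1 : ∀ k, ‖c k‖⁻¹ * (p k).eval (y k) =
        ∑ l, (‖c k‖⁻¹ • c k) l * (b l : MvPolynomial (Fin n) ℝ).eval (y k) := fun k => by
      have : p k = (b.equivFun.symm (c k) : W) := by simp [c, w]
      rw [this, heval, Finset.mul_sum]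
      simp [mul_assoc]
    simp only [h1]
    refine tendsto_finsetSum _ fun l _ => ((tendsto_pi_nhds.1 hlim l).mul ?_)
    exact ((MvPolynomial.continuous_eval _).tendsto x).comp (hy.comp hφ.tendsto_atTop)

end Polynomials

end SwitchedSystem

theorem mainTheorem4 (n : ℕ) (hn : 2 ≤ n) (m : ℕ) (hm : 1 ≤ m) :
    ¬ SwitchedSystem.IsUniversalClass (SwitchedSystem.polynomialsOfDegreeLE n m) := by
  open SwitchedSystem Filter Topology in
  intro hU
  have hε : ∀ k : ℕ, 0 < 1 / ((k : ℝ) + 1) ^ 2 := fun k => by positivity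
  choose V hVP hV using fun k : ℕ => hU _ (isBounded_relaxations (n := n) (1 / ((k : ℝ) + 1) ^ 2))
    (uniformlyExponentiallyStable_relaxations (hε k))
  choose p hdeg hp using hVP
  have hp0 : ∀ k, p k ≠ 0 := fun k h => by
    have h1 := (hV k).pos (Pi.single ⟨0, by omega⟩ 1) (by simp)
    simp [hp, h] at h1
  obtain ⟨q, r, φ, hq, hr, -, hlim⟩ := exists_subseq_tendsto_eval hdeg hp0
  -- The points of evaluation move with `k`, so convergence along `y k → x` is needed.
  have hle : ∀ i j : Fin n, i ≠ j → ∀ σ ∈ Set.Icc (-1 : ℝ) 1, ∀ x : Fin n → ℝ,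
      q.eval (Function.update x i (σ * x j)) ≤ q.eval x := fun i j hij σ hσ x => by
    refine le_of_tendsto_of_tendsto' (hlim _ _ (tendsto_relaxationFlow i j σ x))
      (hlim _ _ (tendsto_const_nhds (x := x))) fun k => ?_
    rw [← hp, ← hp]
    exact mul_le_mul_of_nonneg_left
      ((hV (φ k)).relaxationFlow_le hij hσ x (by positivity)) (hr _).le
  have hq0 : q.eval 0 = 0 := by
    refine tendsto_nhds_unique (hlim _ _ (tendsto_const_nhds (x := 0))) ?_
    simp only [← hp, (hV _).map_zero, mul_zero, tendsto_const_nhds]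
  have : Nontrivial (Fin n) := Fin.nontrivial_iff_two_le.2 hn
  refine hq (MvPolynomial.funext fun x => ?_)
  rw [eval_eq_eval_zero (fun i x => ?_) x, hq0, map_zero]
  -- Each coordinate needs a distinct partner `j`; here `n ≥ 2` enters.
  obtain ⟨j, hj⟩ := exists_ne i
  exact eval_update_eq hj.symm (hle i j hj.symm) x 0
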